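/- Let $\mathcal H$ be a separable complex Hilbert space and $1\le p<\infty$. For a bounded real linear operator $R$ on $\mathcal H$ write $R=C+A$, where $C=\frac12(R-iRi)$ is its complex linear part and $A=\frac12(R+iRi)$ its antilinear part; $R$ is compact if $C$ and $A$ are compact. The singular numbers of a compact complex linear or antilinear operator $T$ are the square roots $s_j(T)$, $j\ge 1$, of the eigenvalues of $T^*T$, listed in decreasing order with multiplicity and continued by zeros; $T$ is in the Schatten $p$-class if $(s_j(T))_j\in\ell^p$, and $\|T\|_p^p=\sum_j s_j(T)^p\in[0,\infty]$. (The adjoint of an antilinear operator $A$ is the antilinear operator $A^*$ with $(Ax,y)=\overline{(x,A^*y)}$.) A compact real linear operator $R=C+A$ is in the Schatten $p$-class $\mathcal B_p(\mathcal H)$ if both $C$ and $A$ are in the Schatten $p$-class. Let $\kappa$ be a unitary conjugation on $\mathcal H$, that is, a bijective isometric antilinear operator with $\kappa^2=I$. The complexification of $R=C+A$ with respect to $\kappa$ is the complex linear operator $$R^{\mathbb C}=\begin{bmatrix} C & A\kappa\\ \kappa A & \kappa C\kappa\end{bmatrix}$$ on $\mathcal H\oplus\mathcal H$. Let $R=C+A$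 be a compact real linear operator on $\mathcal H$. Then $R^{\mathbb C}\in\mathcal B_p(\mathcal H\oplus\mathcal H)$ (that is, $R^{\mathbb C}$ is compact and in the Schatten $p$-class) if and only if $R\in\mathcal B_p(\mathcal H)$. Moreover, as relations in $[0,\infty]$, $$\|R^{\mathbb C}\|_p^p\ \ge\ \|C\|_p^p+\|A\|_p^p,\qquad \|C^{\mathbb C}\|_p^p=2\|C\|_p^p,\qquad \|A^{\mathbb C}\|_p^p=2\|A\|_p^p .$$ -/

import Mathlib

open scoped ENNReal ComplexConjugate

noncomputable section

namespace RealLinear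

variable {H : Type*} [NormedAddCommGroup H] [InnerProductSpace ℂ H]

/-- The complex linear part `C = (R - i R i) / 2` of a real linear operator `R`. -/
def linearPart (R : H →L[ℝ] H) : H →L[ℂ] H where
  toFun x := (1 / 2 : ℂ) • (R x - Complex.I • R (Complex.I • x))
  map_add' x y := by
    simp only [smul_add, map_add]
    module
  map_smul' c x := by
    have h1 : c • x = c.re • x + c.im • (Complex.I • x) := by
      conv_lhs => rw [← Complex.re_add_im c]
      rw [add_smul, mul_smul, Complex.coe_smul, Complex.coe_smul]
    have h2 : Complex.I • c • x = c.re • (Complex.I • x) - c.im • x := by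
      rw [h1, smul_add, smul_comm, smul_comm Complex.I c.im, smul_smul Complex.I Complex.I,
        Complex.I_mul_I, neg_one_smul, smul_neg, sub_eq_add_neg]
    have h3 : ∀ (r : ℝ) (z : H), r • z = (r : ℂ) • z := fun r z => (Complex.coe_smul r z).symm
    rw [h2, h1]
    simp only [map_add, map_sub, map_smul]
    simp only [h3, RingHom.id_apply]
    nth_rewrite 5 [← Complex.re_add_im c]
    match_scalars <;> first | ring1 | linear_combination (c.im / 2 : ℂ) * Complex.I_sq
  cont := by fun_prop

/-- The antilinear part `A = (R + i R i) / 2` of a real linear operator `R`. -/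
def antilinearPart (R : H →L[ℝ] H) : H →L⋆[ℂ] H where
  toFun x := (1 / 2 : ℂ) • (R x + Complex.I • R (Complex.I • x))
  map_add' x y := by
    simp only [smul_add, map_add]
    module
  map_smul' c x := by
    have h1 : c • x = c.re • x + c.im • (Complex.I • x) := by
      conv_lhs => rw [← Complex.re_add_im c]
      rw [add_smul, mul_smul, Complex.coe_smul, Complex.coe_smul]
    have h2 : Complex.I • c • x = c.re • (Complex.I • x) - c.im • x := by
      rw [h1, smul_add, smul_comm, smul_comm Complex.I c.im, smul_smul Complex.I Complex.I,
        Complex.I_mul_I, neg_one_smul, smul_neg, sub_eq_add_neg]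
    have h3 : ∀ (r : ℝ) (z : H), r • z = (r : ℂ) • z := fun r z => (Complex.coe_smul r z).symm
    have h4 : conj c = (c.re : ℂ) - c.im * Complex.I := by
      apply Complex.ext <;> simp
    rw [h2, h1]
    simp only [map_add, map_sub, map_smul]
    simp only [h3, h4]
    match_scalars <;> first | ring1 | linear_combination (c.im / 2 : ℂ) * Complex.I_sq
  cont := by fun_prop

/-- An antilinear operator, regarded as a real linear operator. -/
def antilinearToReal (A : H →L⋆[ℂ] H) : H →L[ℝ] H where
  toFun := A
  map_add' := map_add A
  map_smul' r x := by
    rw [← Complex.coe_smul, map_smulₛₗ, Complex.conj_ofReal, Complex.coe_smul, RingHom.id_apply]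
  cont := A.continuous

/-- `R = C + A`. -/
theorem linearPart_add_antilinearPart (R : H →L[ℝ] H) :
    (linearPart R).restrictScalars ℝ + antilinearToReal (antilinearPart R) = R := by
  ext x
  change (1 / 2 : ℂ) • (R x - Complex.I • R (Complex.I • x)) +
    (1 / 2 : ℂ) • (R x + Complex.I • R (Complex.I • x)) = R x
  module

/-- A real linear operator is compact if its complex linear part and its antilinear part are. -/
def IsCompactRealLinear (R : H →L[ℝ] H) : Prop :=
  IsCompactOperator (linearPart R) ∧ IsCompactOperator (antilinearPart R)

/-- The complexification of `R = C + A` with respect to `κ`, that is the operator with the blocks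
`C`, `A κ` (first row) and `κ A`, `κ C κ` (second row), on the Hilbert space sum `H ⊕ H`. -/
def complexification (κ : H ≃ₗᵢ⋆[ℂ] H) (R : H →L[ℝ] H) :
    WithLp 2 (H × H) →L[ℂ] WithLp 2 (H × H) :=
  let C : H →L[ℂ] H := linearPart R
  let A : H →L⋆[ℂ] H := antilinearPart R
  let k : H →L⋆[ℂ] H := (κ.toContinuousLinearEquiv : H →L⋆[ℂ] H)
  let Ak : H →L[ℂ] H := A.comp k
  let kA : H →L[ℂ] H := k.comp A
  let Ck : H →L⋆[ℂ] H := C.comp k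
  let kCk : H →L[ℂ] H := k.comp Ck
  let e := WithLp.prodContinuousLinearEquiv 2 ℂ H H
  let x₁ := ContinuousLinearMap.fst ℂ H H
  let x₂ := ContinuousLinearMap.snd ℂ H H
  (e.symm : (H × H) →L[ℂ] WithLp 2 (H × H)).comp
    (((C.comp x₁ + Ak.comp x₂).prod (kA.comp x₁ + kCk.comp x₂)).comp
      (e : WithLp 2 (H × H) →L[ℂ] (H × H)))

theorem complexification_apply (κ : H ≃ₗᵢ⋆[ℂ] H) (R : H →L[ℝ] H) (x y : H) :
    complexification κ R (WithLp.toLp 2 (x, y)) =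
      WithLp.toLp 2 (linearPart R x + antilinearPart R (κ y),
        κ (antilinearPart R x) + κ (linearPart R (κ y))) := rfl

/-- The `j`-th eigenvalue (`j = 0, 1, …`) of a positive compact operator `S`, the positive
eigenvalues being listed in decreasing order, repeated by multiplicity and continued by zeros:
the least `t ≥ 0` such that at most `j` eigenvalues, counted with multiplicity, exceed `t`.
As eigenspaces are linearly independent, the rank of their sum is that count. -/
def eigenvalueSeq (S : H →L[ℂ] H) (j : ℕ) : ℝ :=
  sInf {t : ℝ | 0 ≤ t ∧
    Module.rank ℂ
      (⨆ μ ∈ Set.Ioi t, Module.End.eigenspace (S : H →ₗ[ℂ] H) (μ : ℂ) : Submodule ℂ H) ≤ j}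

variable [CompleteSpace H]

/-- The adjoint `A*` of an antilinear operator `A`; it is antilinear. -/
def antilinearAdjoint (A : H →L⋆[ℂ] H) : H →L⋆[ℂ] H :=
  ((InnerProductSpace.toDual ℂ H).symm.toContinuousLinearEquiv :
      StrongDual ℂ H →L⋆[ℂ] H).comp
    (((ContinuousLinearMap.compSL H H ℂ (starRingEnd ℂ) (starRingEnd ℂ)).flip A).comp
      (innerSLFlip ℂ (E := H)))

/-- The defining property of the adjoint of an antilinear operator. -/
theorem inner_antilinearAdjoint (A : H →L⋆[ℂ] H) (x y : H) :
    inner ℂ (antilinearAdjoint A y) x = inner ℂ (A x) y := by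
  simp [antilinearAdjoint]

/-- The singular numbers `s_j(T)` of a compact complex linear operator: the square roots of
the eigenvalues of `T* T`. -/
def singularNumber (T : H →L[ℂ] H) (j : ℕ) : ℝ :=
  √(eigenvalueSeq ((ContinuousLinearMap.adjoint T).comp T) j)

/-- The singular numbers `s_j(A)` of a compact antilinear operator: the square roots of the
eigenvalues of the complex linear operator `A* A`. -/
def antilinearSingularNumber (A : H →L⋆[ℂ] H) (j : ℕ) : ℝ :=
  √(eigenvalueSeq ((antilinearAdjoint A).comp A) j)

/-- The complex linear operator `T` is in the Schatten `p`-class. -/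
def MemSchatten (p : ℝ) (T : H →L[ℂ] H) : Prop :=
  IsCompactOperator T ∧ Memℓp (singularNumber T) (ENNReal.ofReal p)

/-- The antilinear operator `A` is in the Schatten `p`-class. -/
def AntilinearMemSchatten (p : ℝ) (A : H →L⋆[ℂ] H) : Prop :=
  IsCompactOperator A ∧ Memℓp (antilinearSingularNumber A) (ENNReal.ofReal p)

/-- The real linear operator `R` is in the Schatten `p`-class. -/
def RealMemSchatten (p : ℝ) (R : H →L[ℝ] H) : Prop :=
  MemSchatten p (linearPart R) ∧ AntilinearMemSchatten p (antilinearPart R)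

/-- The Schatten norm `‖T‖_p`, with values in `[0, ∞]`, of a compact complex linear operator. -/
def schattenNorm (p : ℝ) (T : H →L[ℂ] H) : ℝ≥0∞ :=
  (∑' j, ENNReal.ofReal (singularNumber T j) ^ p) ^ (1 / p)

/-- The Schatten norm `‖A‖_p`, with values in `[0, ∞]`, of a compact antilinear operator. -/
def antilinearSchattenNorm (p : ℝ) (A : H →L⋆[ℂ] H) : ℝ≥0∞ :=
  (∑' j, ENNReal.ofReal (antilinearSingularNumber A j) ^ p) ^ (1 / p)

end RealLinear

end

/-! Split `R^ℂ = D + O` with `D = C^ℂ` block diagonal and `O = A^ℂ` block antidiagonal. The operator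
`B = κA` is complex linear and `B*B = A*A`, so `A` has the singular numbers of `B`. The blocks of
`D` are `C` and `κCκ`, those of `O` are `B` and `Aκ = κBκ`. Since `κ` carries a singular
decomposition of `T` to one of `κTκ` with the same coefficients, every singular number is doubled in
`D` and in `O`; this gives both equalities.

The inequality rests on the estimate `∑ |⟨fᵢ, T eᵢ⟩|^p ≤ ∑ sₖ(T)^p` for orthonormal families and `p
≥ 1` (`tsum_enorm_inner_rpow_le`). Take the singular vectors of `D`: there `O` has zero matrix
elements, so `‖D‖_p^p ≤ ‖R^ℂ‖_p^p`. The same holds with `D` and `O` exchanged. Adding and halving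
gives the claim, hence one half of the equivalence. The other half is a `p`-th power triangle
inequality for `D + O`, from the same estimate. -/

open scoped ENNReal ComplexConjugate

noncomputable section

namespace RealLinear

universe u

variable {H : Type u} [NormedAddCommGroup H] [InnerProductSpace ℂ H]

/-! ### Singular decompositions determine the singular numbers -/

/-- A singular value decomposition `T x = ∑ₖ sₖ ⟨uₖ, x⟩ vₖ`, with an arbitrary index type. -/
structure IsSingularDecomposition {ι : Type*} (T : H →L[ℂ] H) (u v : ι → H) (s : ι → ℝ) :
    Prop where
  left : Orthonormal ℂ u
  right : Orthonormal ℂ v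
  nonneg : ∀ k, 0 ≤ s k
  hasSum : ∀ x, HasSum (fun k => ((s k : ℂ) * inner ℂ (u k) x) • v k) (T x)

namespace IsSingularDecomposition

variable {ι : Type*} {T : H →L[ℂ] H} {u v : ι → H} {s : ι → ℝ}

theorem apply_left (h : IsSingularDecomposition T u v s) (k : ι) :
    T (u k) = (s k : ℂ) • v k := by
  classical
  have h1 := hasSum_single (f := fun b => ((s b : ℂ) * inner ℂ (u b) (u k)) • v b) k
    fun b hb => by rw [h.left.2 hb, mul_zero, zero_smul]
  rw [(h.hasSum (u k)).unique h1, inner_self_eq_norm_sq_to_K, h.left.1 k]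
  simp

theorem inner_right (h : IsSingularDecomposition T u v s) (k : ι) (x : H) :
    inner ℂ (v k) (T x) = s k * inner ℂ (u k) x := by
  classical
  have h1 := (h.hasSum x).mapL (innerSL ℂ (v k))
  simp only [innerSL_apply_apply, inner_smul_right] at h1
  have h2 := hasSum_single (f := fun b => (s b : ℂ) * inner ℂ (u b) x * inner ℂ (v k) (v b)) k
    fun b hb => by rw [h.right.2 hb.symm, mul_zero]
  rw [h1.unique h2, inner_self_eq_norm_sq_to_K, h.right.1 k]
  simp

theorem le_norm (h : IsSingularDecomposition T u v s) (k : ι) : s k ≤ ‖T‖ := by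
  have h1 := T.le_opNorm (u k)
  rw [h.apply_left, norm_smul, h.left.1, h.right.1] at h1
  simpa [abs_of_nonneg (h.nonneg k)] using h1

variable [CompleteSpace H]

theorem adjoint_right (h : IsSingularDecomposition T u v s) (k : ι) :
    ContinuousLinearMap.adjoint T (v k) = (s k : ℂ) • u k := by
  refine ext_inner_right ℂ fun x => ?_
  rw [ContinuousLinearMap.adjoint_inner_left, h.inner_right, inner_smul_left, Complex.conj_ofReal]

theorem hasSum_adjoint_comp (h : IsSingularDecomposition T u v s) (x : H) :
    HasSum (fun k => (((s k ^ 2 : ℝ) : ℂ) * inner ℂ (u k) x) • u k)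
      ((ContinuousLinearMap.adjoint T).comp T x) := by
  have h1 := (h.hasSum x).mapL (ContinuousLinearMap.adjoint T)
  rw [ContinuousLinearMap.comp_apply]
  convert! h1 using 2
  rw [map_smul, h.adjoint_right, smul_smul]
  push_cast
  ring_nf

theorem adjoint_comp_left (h : IsSingularDecomposition T u v s) (k : ι) :
    (ContinuousLinearMap.adjoint T).comp T (u k) = ((s k ^ 2 : ℝ) : ℂ) • u k := by
  rw [ContinuousLinearMap.comp_apply, h.apply_left, map_smul, h.adjoint_right, smul_smul]
  push_cast
  ring_nf

theorem inner_adjoint_comp (h : IsSingularDecomposition T u v s) (k : ι) (x : H) :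
    inner ℂ (u k) ((ContinuousLinearMap.adjoint T).comp T x)
      = ((s k ^ 2 : ℝ) : ℂ) * inner ℂ (u k) x := by
  rw [ContinuousLinearMap.comp_apply, ContinuousLinearMap.adjoint_inner_right, h.apply_left,
    inner_smul_left, Complex.conj_ofReal, h.inner_right]
  push_cast
  ring

/-- The `u k` with `s k ^ 2 > t` are independent eigenvectors in the sum. Conversely, if `T*T x = μ
x` with `μ > t`, pairing with `u k` gives `(μ - s k ^ 2) ⟨u k, x⟩ = 0`, so only indices with `s k ^
2 > t` survive in the expansion of `μ x`, and `μ ≠ 0` recovers `x`. -/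
theorem rank_eigenspaces_le_iff (h : IsSingularDecomposition T u v s) {t : ℝ} (ht : 0 ≤ t)
    (j : ℕ) :
    Module.rank ℂ (⨆ μ ∈ Set.Ioi t, Module.End.eigenspace
      ((ContinuousLinearMap.adjoint T).comp T : H →ₗ[ℂ] H) (μ : ℂ) : Submodule ℂ H) ≤ j ↔
    {k | t < s k ^ 2}.encard ≤ j := by
  set S := (ContinuousLinearMap.adjoint T).comp T with hS
  set E : Submodule ℂ H := ⨆ μ ∈ Set.Ioi t, Module.End.eigenspace (S : H →ₗ[ℂ] H) (μ : ℂ)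
  have hmem : ∀ k, t < s k ^ 2 → u k ∈ E := fun k hk =>
    Submodule.mem_iSup_of_mem (s k ^ 2) (Submodule.mem_iSup_of_mem hk
      (Module.End.mem_eigenspace_iff.2 (h.adjoint_comp_left k)))
  constructor
  · intro hr
    let w : {k | t < s k ^ 2} → E := fun k => ⟨u k, hmem k k.2⟩
    have hw : LinearIndependent ℂ w := by
      apply LinearIndependent.of_comp E.subtype
      exact h.left.linearIndependent.comp _ Subtype.val_injective
    have h1 := hw.cardinal_lift_le_rank.trans (Cardinal.lift_le.2 hr)
    rw [Cardinal.lift_natCast, Cardinal.lift_le_nat_iff] at h1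
    exact Cardinal.toENat_le_natCast.2 h1
  · intro hc
    have hfin : {k | t < s k ^ 2}.Finite := Set.finite_of_encard_le_coe hc
    have hle : E ≤ Submodule.span ℂ (u '' {k | t < s k ^ 2}) := by
      refine iSup₂_le fun μ hμ x hx => ?_
      have hμ' : t < μ := hμ
      have hμ0 : (μ : ℂ) ≠ 0 := by exact_mod_cast (ht.trans_lt hμ').ne'
      have hx' : S x = (μ : ℂ) • x := Module.End.mem_eigenspace_iff.1 hx
      have hz : ∀ k, k ∉ hfin.toFinset →
          (((s k ^ 2 : ℝ) : ℂ) * inner ℂ (u k) x) • u k = 0 := by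
        intro k hk
        have hk' : s k ^ 2 ≤ t := by simpa using hk
        have h1 := h.inner_adjoint_comp k x
        rw [← hS, hx', inner_smul_right] at h1
        have h2 : ((μ : ℂ) - ((s k ^ 2 : ℝ) : ℂ)) * inner ℂ (u k) x = 0 := by
          rw [sub_mul, h1, sub_self]
        have h3 : ((μ : ℂ) - ((s k ^ 2 : ℝ) : ℂ)) ≠ 0 := by
          rw [← Complex.ofReal_sub]
          exact_mod_cast (sub_pos.2 (hk'.trans_lt hμ')).ne'
        rw [(mul_eq_zero.1 h2).resolve_left h3, mul_zero, zero_smul]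
      have h4 := (h.hasSum_adjoint_comp x).unique (hasSum_sum_of_ne_finset_zero hz)
      rw [← hS, hx'] at h4
      have h5 : x = (μ : ℂ)⁻¹ • ((μ : ℂ) • x) := by rw [smul_smul, inv_mul_cancel₀ hμ0, one_smul]
      rw [h5, h4]
      refine Submodule.smul_mem _ _ (Submodule.sum_mem _ fun k hk => Submodule.smul_mem _ _
        (Submodule.subset_span ⟨k, by simpa using hk, rfl⟩))
    refine (Submodule.rank_mono hle).trans ((rank_span_le _).trans ?_)
    exact Cardinal.toENat_le_natCast.1 ((Set.encard_image_le _ _).trans hc)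

theorem lt_eigenvalueSeq_iff (h : IsSingularDecomposition T u v s) {t : ℝ} (ht : 0 ≤ t) (j : ℕ) :
    t < eigenvalueSeq ((ContinuousLinearMap.adjoint T).comp T) j ↔
      (j : ℕ∞) < {k | t < s k ^ 2}.encard := by
  have hQ : eigenvalueSeq ((ContinuousLinearMap.adjoint T).comp T) j
      = sInf {t : ℝ | 0 ≤ t ∧ {k | t < s k ^ 2}.encard ≤ j} := by
    unfold eigenvalueSeq
    congr 1
    ext r
    exact and_congr_right fun hr => h.rank_eigenspaces_le_iff hr j
  rw [hQ]
  constructor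
  · intro hlt
    by_contra! hc
    exact hlt.not_ge (csInf_le ⟨0, fun _ hr => hr.1⟩ ⟨ht, hc⟩)
  · intro hlt
    -- Among `j + 1` indices with `s k ^ 2 > t`, the least value `s m ^ 2` is a lower bound of the
    -- set defining the infimum, which makes the inequality strict.
    obtain ⟨F, hF, hcard⟩ := Set.exists_subset_encard_eq (Order.add_one_le_of_lt hlt)
    have hfin : F.Finite := Set.finite_of_encard_eq_coe (k := j + 1) (by rw [hcard]; norm_cast)
    have hne : F.Nonempty := by
      rw [← Set.encard_ne_zero, hcard]
      simp
    obtain ⟨m, hm, hmin⟩ := Set.exists_min_image F (fun k => s k ^ 2) hfin hne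
    refine (show t < s m ^ 2 from hF hm).trans_le (le_csInf ⟨‖T‖ ^ 2, sq_nonneg _, ?_⟩ ?_)
    -- The set is nonempty: it contains `‖T‖ ^ 2`.
    · have he : {k | ‖T‖ ^ 2 < s k ^ 2} = ∅ := by
        ext k
        simpa using pow_le_pow_left₀ (h.nonneg k) (h.le_norm k) 2
      simp [he]
    · rintro r ⟨-, hr⟩
      by_contra! hlt'
      have h1 : F ⊆ {k | r < s k ^ 2} := fun k hk => hlt'.trans_le (hmin k hk)
      have h2 := (Set.encard_le_encard h1).trans hr
      rw [hcard] at h2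
      exact absurd h2 (by exact_mod_cast (Nat.lt_succ_self j).not_ge)

theorem lt_singularNumber_iff (h : IsSingularDecomposition T u v s) {t : ℝ} (ht : 0 ≤ t) (j : ℕ) :
    t < singularNumber T j ↔ (j : ℕ∞) < {k | t < s k}.encard := by
  rw [singularNumber, Real.lt_sqrt ht, h.lt_eigenvalueSeq_iff (sq_nonneg t)]
  simp only [sq_lt_sq₀ ht (h.nonneg _)]

/-- Equality of distribution functions allows any decomposition, unordered and over any index type,
to replace the decreasing sequence of singular numbers. -/
theorem encard_lt_singularNumber (h : IsSingularDecomposition T u v s) {t : ℝ} (ht : 0 ≤ t) :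
    {j | t < singularNumber T j}.encard = {k | t < s k}.encard := by
  simp only [h.lt_singularNumber_iff ht]
  generalize {k | t < s k}.encard = N
  induction N using ENat.recTopCoe with
  | top => simp
  | coe n =>
    have hn : {j : ℕ | (j : ℕ∞) < n} = ↑(Finset.range n) := by ext; simp
    rw [hn, Set.encard_coe_eq_coe_finsetCard, Finset.card_range]

end IsSingularDecomposition

/-! ### Schatten norms from distribution functions -/

/-- The layer cake formula for counting measure, with the discrete σ-algebra so that every function
is measurable. -/
theorem tsum_rpow_eq_lintegral_encard {α : Type*} {f : α → ℝ} (hf : ∀ a, 0 ≤ f a) {p : ℝ}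
    (hp : 0 < p) :
    ∑' a, ENNReal.ofReal (f a) ^ p = ENNReal.ofReal p *
      ∫⁻ t in Set.Ioi 0, ({a | t < f a}.encard : ℝ≥0∞) * ENNReal.ofReal (t ^ (p - 1)) := by
  let _ : MeasurableSpace α := ⊤
  have h := MeasureTheory.lintegral_rpow_eq_lintegral_meas_lt_mul MeasureTheory.Measure.count
    (Filter.Eventually.of_forall hf) (measurable_from_top (f := f)).aemeasurable hp
  rw [MeasureTheory.lintegral_count' measurable_from_top] at h
  simp only [MeasureTheory.Measure.count_apply MeasurableSpace.measurableSet_top] at h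
  rw [← h]
  exact tsum_congr fun a => ENNReal.ofReal_rpow_of_nonneg (hf a) hp.le

/-- The sum of the `p`-th powers depends only on the distribution function. -/
theorem tsum_rpow_eq_of_encard_eq {α β : Type*} {f : α → ℝ} {g : β → ℝ} (hf : ∀ a, 0 ≤ f a)
    (hg : ∀ b, 0 ≤ g b) (hfg : ∀ t, 0 < t → {a | t < f a}.encard = {b | t < g b}.encard)
    {p : ℝ} (hp : 0 < p) :
    ∑' a, ENNReal.ofReal (f a) ^ p = ∑' b, ENNReal.ofReal (g b) ^ p := by
  rw [tsum_rpow_eq_lintegral_encard hf hp, tsum_rpow_eq_lintegral_encard hg hp]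
  congr 1
  refine MeasureTheory.setLIntegral_congr_fun measurableSet_Ioi fun t ht => ?_
  simp only [hfg t ht]

section Schatten

variable [CompleteSpace H]

theorem singularNumber_nonneg (T : H →L[ℂ] H) (j : ℕ) : 0 ≤ singularNumber T j :=
  Real.sqrt_nonneg _

theorem schattenNorm_rpow (T : H →L[ℂ] H) {p : ℝ} (hp : 0 < p) :
    schattenNorm p T ^ p = ∑' j, ENNReal.ofReal (singularNumber T j) ^ p := by
  rw [schattenNorm, ← ENNReal.rpow_mul, one_div_mul_cancel hp.ne', ENNReal.rpow_one]

theorem IsSingularDecomposition.schattenNorm_rpow {ι : Type*} {T : H →L[ℂ] H} {u v : ι → H}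
    {s : ι → ℝ} (h : IsSingularDecomposition T u v s) {p : ℝ} (hp : 0 < p) :
    schattenNorm p T ^ p = ∑' k, ENNReal.ofReal (s k) ^ p := by
  rw [RealLinear.schattenNorm_rpow T hp]
  exact tsum_rpow_eq_of_encard_eq (singularNumber_nonneg T) h.nonneg
    (fun t ht => h.encard_lt_singularNumber ht.le) hp

theorem memSchatten_iff (T : H →L[ℂ] H) {p : ℝ} (hp : 0 < p) :
    MemSchatten p T ↔ IsCompactOperator T ∧ schattenNorm p T ^ p ≠ ⊤ := by
  refine and_congr_right fun _ => ?_
  have hp' : (ENNReal.ofReal p).toReal = p := ENNReal.toReal_ofReal hp.le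
  have h1 : ∀ j, ENNReal.ofReal (singularNumber T j) ^ p
      = ENNReal.ofReal (‖singularNumber T j‖ ^ p) := fun j => by
    rw [Real.norm_of_nonneg (singularNumber_nonneg T j),
      ENNReal.ofReal_rpow_of_nonneg (singularNumber_nonneg T j) hp.le]
  rw [memℓp_gen_iff (by rw [hp']; exact hp), hp', schattenNorm_rpow T hp, tsum_congr h1]
  refine ⟨fun h => h.tsum_ofReal_ne_top, fun h => ?_⟩
  refine (ENNReal.summable_toReal h).congr fun j => ?_
  exact ENNReal.toReal_ofReal (by positivity)

end Schatten

/-! ### Existence of singular decompositions -/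

/-- A compact self-adjoint operator has a Hilbert basis of eigenvectors. -/
theorem exists_hilbertBasis_eigenvectors [CompleteSpace H] {S : H →L[ℂ] H}
    (hS : IsCompactOperator S) (hS' : (S : H →ₗ[ℂ] H).IsSymmetric) :
    ∃ (ι : Type u) (b : HilbertBasis ι ℂ H) (μ : ι → ℂ), ∀ k, S (b k) = μ k • b k := by
  have hcl : ∀ μ : ℂ, CompleteSpace (Module.End.eigenspace (S : H →ₗ[ℂ] H) μ) := fun μ => by
    have h1 : IsClosed (Module.End.eigenspace (S : H →ₗ[ℂ] H) μ : Set H) := by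
      have h2 : (Module.End.eigenspace (S : H →ₗ[ℂ] H) μ : Set H) = {x | S x = μ • x} := by
        ext x; simp
      rw [h2]
      exact isClosed_eq S.continuous (by fun_prop)
    exact h1.completeSpace_coe
  choose w b _ using fun μ : ℂ =>
    exists_hilbertBasis ℂ (Module.End.eigenspace (S : H →ₗ[ℂ] H) μ)
  have hort : Orthonormal ℂ fun a : Σ μ, w μ => ((b a.1 a.2 : _) : H) :=
    hS'.orthogonalFamily_eigenspaces.orthonormal_sigma_orthonormal
    (fun μ => (b μ).orthonormal)
  -- A vector orthogonal to the bases chosen in the eigenspaces is orthogonal to every eigenspace,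
  -- hence zero by the spectral theorem.
  have hspan : (Submodule.span ℂ (Set.range fun a : Σ μ, w μ => ((b a.1 a.2 : _) : H)))ᗮ = ⊥ := by
    rw [eq_bot_iff, ← ContinuousLinearMap.orthogonalComplement_iSup_eigenspaces_eq_bot hS hS']
    intro x hx
    rw [Submodule.mem_orthogonal'] at hx ⊢
    intro y hy
    refine Submodule.iSup_induction _ (motive := fun y => inner ℂ x y = 0) hy ?_ (by simp)
      fun y z h1 h2 => by rw [inner_add_right, h1, h2, add_zero]
    intro μ y hy
    have h3 := ((b μ).hasSum_repr ⟨y, hy⟩).mapL (Submodule.subtypeL _)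
    have h4 := h3.mapL (innerSL ℂ x)
    refine h4.unique ?_
    convert! hasSum_zero using 2 with k
    have h5 := hx _ (Submodule.subset_span ⟨⟨μ, k⟩, rfl⟩)
    simp [h5]
  refine ⟨Σ μ, w μ, HilbertBasis.mkOfOrthogonalEqBot hort hspan, fun a => a.1, fun a => ?_⟩
  rw [HilbertBasis.coe_mkOfOrthogonalEqBot]
  exact Module.End.mem_eigenspace_iff.1 (b a.1 a.2).2

/-- For an eigenbasis `b` of `T*T`, the vectors `T (b i)` are pairwise orthogonal. Normalising the
nonzero ones gives the right vectors, with coefficients `‖T (b i)‖`. -/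
theorem exists_isSingularDecomposition [CompleteSpace H] {T : H →L[ℂ] H}
    (hT : IsCompactOperator T) :
    ∃ (ι : Type u) (u v : ι → H) (s : ι → ℝ), IsSingularDecomposition T u v s := by
  set S := (ContinuousLinearMap.adjoint T).comp T with hS
  have hSc : IsCompactOperator S := hT.clm_comp (ContinuousLinearMap.adjoint T)
  have hSs : (S : H →ₗ[ℂ] H).IsSymmetric := fun x y => by
    simp [hS, ContinuousLinearMap.adjoint_inner_left, ContinuousLinearMap.adjoint_inner_right]
  obtain ⟨ι, b, μ, hb⟩ := exists_hilbertBasis_eigenvectors hSc hSs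
  have hin : ∀ i j, inner ℂ (T (b i)) (T (b j)) = μ j * inner ℂ (b i) (b j) := fun i j => by
    rw [← ContinuousLinearMap.adjoint_inner_right, ← ContinuousLinearMap.comp_apply, ← hS, hb,
      inner_smul_right]
  have h0 : ∀ i j, i ≠ j → inner ℂ (T (b i)) (T (b j)) = 0 := fun i j hij => by
    rw [hin, b.orthonormal.2 hij, mul_zero]
  let κ := {i : ι // T (b i) ≠ 0}
  have hpos : ∀ k : κ, 0 < ‖T (b k)‖ := fun k => norm_pos_iff.2 k.2
  refine ⟨κ, fun k => b k, fun k => ((‖T (b k)‖⁻¹ : ℝ) : ℂ) • T (b k), fun k => ‖T (b k)‖,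
    b.orthonormal.comp _ Subtype.val_injective, ⟨fun k => ?_, fun k l hkl => ?_⟩,
    fun k => norm_nonneg _, fun x => ?_⟩
  · rw [norm_smul, Complex.norm_real, norm_inv, norm_norm, inv_mul_cancel₀ (hpos k).ne']
  · simp only [inner_smul_left, inner_smul_right]
    rw [h0 _ _ fun h => hkl (Subtype.ext h), mul_zero, mul_zero]
  · have h1 := (b.hasSum_repr x).mapL T
    rw [← hasSum_subtype_iff_of_support_subset (s := {i | T (b i) ≠ 0})] at h1
    · convert! h1 using 2
      rename_i k
      have : ((‖T (b k)‖ : ℝ) : ℂ) ≠ 0 := by exact_mod_cast (hpos k).ne'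
      simp only [Function.comp_apply, map_smul, smul_smul, b.repr_apply_apply]
      congr 1
      push_cast
      field_simp
    · intro i hi h2
      apply hi
      simp only [map_smul]
      rw [h2, smul_zero]

/-! ### The estimate for matrix elements -/

/-- By `ab ≤ (a² + b²) / 2` and Bessel's inequality for each family. -/
theorem enorm_inner_mul_sum_le_one {ι : Type*} {u v : ι → H} (hu : Orthonormal ℂ u)
    (hv : Orthonormal ℂ v) {x y : H} (hx : ‖x‖ ≤ 1) (hy : ‖y‖ ≤ 1) :
    ∑' k, ‖inner ℂ (u k) x‖ₑ * ‖inner ℂ (v k) y‖ₑ ≤ 1 := by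
  rw [ENNReal.tsum_eq_iSup_sum]
  refine iSup_le fun F => ?_
  have h1 : ∀ k, ‖inner ℂ (u k) x‖ₑ * ‖inner ℂ (v k) y‖ₑ
      = ENNReal.ofReal (‖inner ℂ (u k) x‖ * ‖inner ℂ (v k) y‖) := fun k => by
    rw [ENNReal.ofReal_mul (norm_nonneg _), ofReal_norm, ofReal_norm]
  rw [Finset.sum_congr rfl fun k _ => h1 k, ← ENNReal.ofReal_sum_of_nonneg fun k _ => by positivity]
  rw [ENNReal.ofReal_le_one]
  have h2 := hu.sum_inner_products_le x (s := F)
  have h3 := hv.sum_inner_products_le y (s := F)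
  have h4 : ∑ k ∈ F, ‖inner ℂ (u k) x‖ * ‖inner ℂ (v k) y‖ ≤
      ∑ k ∈ F, (‖inner ℂ (u k) x‖ ^ 2 + ‖inner ℂ (v k) y‖ ^ 2) / 2 :=
    Finset.sum_le_sum fun k _ => by linarith [two_mul_le_add_sq ‖inner ℂ (u k) x‖ ‖inner ℂ (v k) y‖]
  rw [← Finset.sum_div, Finset.sum_add_distrib] at h4
  have h5 := pow_le_one₀ (n := 2) (norm_nonneg _) hx
  have h6 := pow_le_one₀ (n := 2) (norm_nonneg _) hy
  linarith

/-- Jensen's inequality for weights of total mass at most one. -/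
theorem tsum_mul_rpow_le {ι : Type*} {w f : ι → ℝ≥0∞} (hw : ∑' k, w k ≤ 1) {p : ℝ} (hp : 1 ≤ p) :
    (∑' k, w k * f k) ^ p ≤ ∑' k, w k * f k ^ p := by
  have hp0 : 0 < p := by linarith
  rw [← ENNReal.le_rpow_inv_iff hp0, ENNReal.tsum_eq_iSup_sum]
  -- Weighted Hölder inequality; its extra factor `(∑ w) ^ (1 - p⁻¹)` is at most one.
  refine iSup_le fun F => (ENNReal.inner_le_weight_mul_Lp_of_nonneg F hp w f).trans ?_
  calc _ ≤ 1 ^ (1 - p⁻¹) * (∑' k, w k * f k ^ p) ^ p⁻¹ := by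
        gcongr
        · exact sub_nonneg.2 (inv_le_one_of_one_le₀ hp)
        · exact (ENNReal.sum_le_tsum F).trans hw
        · exact ENNReal.sum_le_tsum F
    _ = _ := by rw [ENNReal.one_rpow, one_mul]

/-- For orthonormal families `e`, `f`, `∑ᵢ |⟨fᵢ, T eᵢ⟩| ^ p` is at most the sum of the `p`-th powers
of the singular numbers. -/
theorem IsSingularDecomposition.tsum_enorm_inner_rpow_le {ι α : Type*} {T : H →L[ℂ] H}
    {u v : ι → H} {s : ι → ℝ} (h : IsSingularDecomposition T u v s) {e f : α → H}
    (he : Orthonormal ℂ e) (hf : Orthonormal ℂ f) {p : ℝ} (hp : 1 ≤ p) :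
    ∑' i, ‖inner ℂ (f i) (T (e i))‖ₑ ^ p ≤ ∑' k, ENNReal.ofReal (s k) ^ p := by
  have hp0 : 0 < p := by linarith
  -- For fixed `i` the weights `|⟨u k, e i⟩| |⟨v k, f i⟩|` have total mass at most one over `k`, so
  -- Jensen's inequality applies.
  have h1 : ∀ i, ‖inner ℂ (f i) (T (e i))‖ₑ ^ p ≤
      ∑' k, ‖inner ℂ (u k) (e i)‖ₑ * ‖inner ℂ (v k) (f i)‖ₑ * ENNReal.ofReal (s k) ^ p := by
    intro i
    refine le_trans (ENNReal.rpow_le_rpow ?_ hp0.le) (tsum_mul_rpow_le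
      (enorm_inner_mul_sum_le_one h.left h.right (he.1 i).le (hf.1 i).le) hp)
    have h2 := (h.hasSum (e i)).mapL (innerSL ℂ (f i))
    simp only [innerSL_apply_apply, inner_smul_right] at h2
    rw [← h2.tsum_eq]
    refine enorm_tsum_le_tsum_enorm.trans (ENNReal.tsum_le_tsum fun k => le_of_eq ?_)
    have h3 : ‖inner ℂ (f i) (v k)‖ₑ = ‖inner ℂ (v k) (f i)‖ₑ := by
      rw [← ofReal_norm, ← ofReal_norm, norm_inner_symm]
    have h4 : ‖(s k : ℂ)‖ₑ = ENNReal.ofReal (s k) := by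
      rw [← ofReal_norm, Complex.norm_real, Real.norm_of_nonneg (h.nonneg k)]
    rw [enorm_mul, enorm_mul, h3, h4]
    ring
  refine (ENNReal.tsum_le_tsum h1).trans ?_
  -- For fixed `k` the same weights also have total mass at most one over `i`.
  rw [ENNReal.tsum_comm]
  refine ENNReal.tsum_le_tsum fun k => ?_
  rw [ENNReal.tsum_mul_right]
  have h5 := enorm_inner_mul_sum_le_one he hf (h.left.1 k).le (h.right.1 k).le
  have h6 : ∀ a b : H, ‖inner ℂ a b‖ₑ = ‖inner ℂ b a‖ₑ := fun a b => by
    rw [← ofReal_norm, ← ofReal_norm, norm_inner_symm]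
  simp only [h6 (u k), h6 (v k)]
  calc _ ≤ 1 * ENNReal.ofReal (s k) ^ p := by gcongr
    _ = _ := one_mul _

/-! ### Conjugations and block operators on `H ⊕ H` -/

/-- Polarization: `κ` preserves norms, and its antilinearity flips the sign of the imaginary terms.
-/
theorem inner_conjugation (κ : H ≃ₗᵢ⋆[ℂ] H) (x y : H) :
    inner ℂ (κ x) (κ y) = inner ℂ y x := by
  have hI : Complex.I • κ y = -κ (Complex.I • y) := by
    rw [map_smulₛₗ, Complex.conj_I, neg_smul, neg_neg]
  rw [← inner_conj_symm y x, inner_eq_sum_norm_sq_div_four, inner_eq_sum_norm_sq_div_four x y]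
  simp only [RCLike.I_to_complex, hI, sub_neg_eq_add, ← sub_eq_add_neg, ← map_add, ← map_sub,
    κ.norm_map]
  simp only [map_div₀, map_add, map_sub, map_mul, map_pow, Complex.conj_I,
    RCLike.conj_ofReal, map_ofNat]
  simp
  ring

theorem orthonormal_conjugation {ι : Type*} (κ : H ≃ₗᵢ⋆[ℂ] H) {u : ι → H}
    (hu : Orthonormal ℂ u) : Orthonormal ℂ fun k => κ (u k) :=
  ⟨fun k => by rw [κ.norm_map, hu.1], fun k l hkl =>
    (inner_conjugation κ _ _).trans (hu.2 hkl.symm)⟩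

/-- The embedding of `H` as the first summand of `H ⊕ H`. -/
def blockInl : H →L[ℂ] WithLp 2 (H × H) :=
  ((WithLp.prodContinuousLinearEquiv 2 ℂ H H).symm : (H × H) →L[ℂ] WithLp 2 (H × H)).comp
    (ContinuousLinearMap.inl ℂ H H)

/-- The embedding of `H` as the second summand of `H ⊕ H`. -/
def blockInr : H →L[ℂ] WithLp 2 (H × H) :=
  ((WithLp.prodContinuousLinearEquiv 2 ℂ H H).symm : (H × H) →L[ℂ] WithLp 2 (H × H)).comp
    (ContinuousLinearMap.inr ℂ H H)

theorem blockInl_apply (x : H) : blockInl x = WithLp.toLp 2 (x, (0 : H)) := rfl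

theorem blockInr_apply (x : H) : blockInr x = WithLp.toLp 2 ((0 : H), x) := rfl

theorem blockInl_add_blockInr (x y : H) : blockInl x + blockInr y = WithLp.toLp 2 (x, y) := by
  rw [blockInl_apply, blockInr_apply, ← WithLp.toLp_add]
  simp

theorem inner_blockInl (a x y : H) : inner ℂ (blockInl a) (WithLp.toLp 2 (x, y)) = inner ℂ a x := by
  simp [blockInl_apply]

theorem inner_blockInr (a x y : H) : inner ℂ (blockInr a) (WithLp.toLp 2 (x, y)) = inner ℂ a y := by
  simp [blockInr_apply]

theorem orthonormal_sumElim {ι ι' : Type*} {u : ι → H} {u' : ι' → H} (hu : Orthonormal ℂ u)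
    (hu' : Orthonormal ℂ u') :
    Orthonormal ℂ (Sum.elim (fun k => blockInl (u k))
      (fun k => blockInr (u' k))) := by
  constructor
  · rintro (k | k)
    · simpa [blockInl_apply, blockInr_apply] using hu.1 k
    · simpa [blockInl_apply, blockInr_apply] using hu'.1 k
  · rintro (k | k) (l | l) h
    · simpa [blockInl_apply, blockInr_apply] using hu.2 (by simpa using h)
    · simp [blockInl_apply, blockInr_apply]
    · simp [blockInl_apply, blockInr_apply]
    · simpa [blockInl_apply, blockInr_apply] using hu'.2 (by simpa using h)

theorem orthonormal_sumElim_swap {ι ι' : Type*} {u : ι → H} {u' : ι' → H} (hu : Orthonormal ℂ u)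
    (hu' : Orthonormal ℂ u') :
    Orthonormal ℂ (Sum.elim (fun k => blockInr (u k))
      (fun k => blockInl (u' k))) := by
  convert! (orthonormal_sumElim hu' hu).comp Sum.swap Sum.swap_leftInverse.injective using 1
  ext (k | k) <;> rfl

namespace IsSingularDecomposition

variable {ι : Type*} {T : H →L[ℂ] H} {u v : ι → H} {s : ι → ℝ}

theorem hasSum_conjugation (h : IsSingularDecomposition T u v s) (κ : H ≃ₗᵢ⋆[ℂ] H)
    (hκ : ∀ x, κ (κ x) = x) (x : H) :
    HasSum (fun k => ((s k : ℂ) * inner ℂ (κ (u k)) x) • κ (v k)) (κ (T (κ x))) := by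
  have h1 := (h.hasSum (κ x)).map κ.toLinearEquiv.toLinearMap.toAddMonoidHom κ.continuous
  convert! h1 using 2 with k
  have h2 : inner ℂ (κ (u k)) x = conj (inner ℂ (u k) (κ x)) := by
    rw [inner_conj_symm, ← inner_conjugation κ (u k), hκ]
  rw [h2]
  change _ = κ (((s k : ℂ) * inner ℂ (u k) (κ x)) • v k)
  rw [map_smulₛₗ, map_mul, Complex.conj_ofReal]

theorem blockDiagonal (h : IsSingularDecomposition T u v s) (κ : H ≃ₗᵢ⋆[ℂ] H)
    (hκ : ∀ x, κ (κ x) = x) {D : WithLp 2 (H × H) →L[ℂ] WithLp 2 (H × H)}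
    (hD : ∀ x y, D (WithLp.toLp 2 (x, y)) = WithLp.toLp 2 (T x, κ (T (κ y)))) :
    IsSingularDecomposition D
      (Sum.elim (fun k => blockInl (u k)) (fun k => blockInr (κ (u k))))
      (Sum.elim (fun k => blockInl (v k)) (fun k => blockInr (κ (v k))))
      (Sum.elim s s) where
  left := orthonormal_sumElim h.left (orthonormal_conjugation κ h.left)
  right := orthonormal_sumElim h.right (orthonormal_conjugation κ h.right)
  nonneg := by rintro (k | k) <;> exact h.nonneg k
  hasSum z := by
    obtain ⟨x, y⟩ := z
    rw [hD, ← blockInl_add_blockInr (T x)]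
    convert! HasSum.sum (f := Sum.elim _ _) ((h.hasSum x).mapL blockInl)
      ((h.hasSum_conjugation κ hκ y).mapL blockInr) using 1
    ext1 (k | k) <;> simp [-WithLp.prod_inner_apply, inner_blockInl, inner_blockInr]

/-- Used with `T = κA`, for which the upper right block `κTκ` is `Aκ`. -/
theorem blockAntidiagonal (h : IsSingularDecomposition T u v s) (κ : H ≃ₗᵢ⋆[ℂ] H)
    (hκ : ∀ x, κ (κ x) = x) {D : WithLp 2 (H × H) →L[ℂ] WithLp 2 (H × H)}
    (hD : ∀ x y, D (WithLp.toLp 2 (x, y)) = WithLp.toLp 2 (κ (T (κ y)), T x)) :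
    IsSingularDecomposition D
      (Sum.elim (fun k => blockInl (u k)) (fun k => blockInr (κ (u k))))
      (Sum.elim (fun k => blockInr (v k)) (fun k => blockInl (κ (v k))))
      (Sum.elim s s) where
  left := orthonormal_sumElim h.left (orthonormal_conjugation κ h.left)
  right := orthonormal_sumElim_swap h.right (orthonormal_conjugation κ h.right)
  nonneg := by rintro (k | k) <;> exact h.nonneg k
  hasSum z := by
    obtain ⟨x, y⟩ := z
    rw [hD, ← blockInl_add_blockInr (κ _), add_comm]
    convert! HasSum.sum (f := Sum.elim _ _) ((h.hasSum x).mapL blockInr)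
      ((h.hasSum_conjugation κ hκ y).mapL blockInl) using 1
    ext1 (k | k) <;> simp [-WithLp.prod_inner_apply, inner_blockInl, inner_blockInr]

theorem schattenNorm_rpow_eq_two_mul [CompleteSpace H] (h : IsSingularDecomposition T u v s)
    {D : WithLp 2 (H × H) →L[ℂ] WithLp 2 (H × H)} {u' v' : ι ⊕ ι → WithLp 2 (H × H)}
    (hD : IsSingularDecomposition D u' v' (Sum.elim s s)) {p : ℝ} (hp : 0 < p) :
    schattenNorm p D ^ p = 2 * schattenNorm p T ^ p := by
  rw [h.schattenNorm_rpow hp, hD.schattenNorm_rpow hp, ENNReal.summable.tsum_sum ENNReal.summable,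
    two_mul]
  rfl

/-- Only the matrix elements of `T` along the singular vectors of `S` enter the estimate, and there
they equal the singular numbers of `S`. It compares `D` or `O` with `D + O`. -/
theorem schattenNorm_rpow_le [CompleteSpace H] {S : H →L[ℂ] H}
    (h : IsSingularDecomposition S u v s)
    (hT : IsCompactOperator T) (hST : ∀ k, inner ℂ (v k) (T (u k)) = inner ℂ (v k) (S (u k)))
    {p : ℝ} (hp : 1 ≤ p) :
    schattenNorm p S ^ p ≤ schattenNorm p T ^ p := by
  have hp0 : 0 < p := by linarith
  obtain ⟨ι', u', v', s', h'⟩ := exists_isSingularDecomposition hT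
  rw [h.schattenNorm_rpow hp0, h'.schattenNorm_rpow hp0]
  refine le_trans (le_of_eq (tsum_congr fun k => ?_))
    (h'.tsum_enorm_inner_rpow_le h.left h.right hp)
  rw [hST, h.inner_right, inner_self_eq_norm_sq_to_K, h.left.1, ← ofReal_norm]
  simp [abs_of_nonneg (h.nonneg k)]

end IsSingularDecomposition

/-! ### The triangle inequality for `p`-th powers -/

/-- Along the singular vectors of `S + T` each coefficient is `⟨v, S u⟩ + ⟨v, T u⟩`; the factor `2 ^
(p - 1)` comes from convexity of the `p`-th power. It is weaker than Minkowski's inequality but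
enough for finiteness. -/
theorem schattenNorm_add_rpow_le [CompleteSpace H] {S T : H →L[ℂ] H} (hS : IsCompactOperator S)
    (hT : IsCompactOperator T) {p : ℝ} (hp : 1 ≤ p) :
    schattenNorm p (S + T) ^ p ≤
      2 ^ (p - 1) * (schattenNorm p S ^ p + schattenNorm p T ^ p) := by
  have hp0 : 0 < p := by linarith
  obtain ⟨ι₁, u₁, v₁, s₁, h₁⟩ := exists_isSingularDecomposition hS
  obtain ⟨ι₂, u₂, v₂, s₂, h₂⟩ := exists_isSingularDecomposition hT
  obtain ⟨ι, u, v, s, h⟩ := exists_isSingularDecomposition (T := S + T) (hS.add hT)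
  rw [h.schattenNorm_rpow hp0, h₁.schattenNorm_rpow hp0, h₂.schattenNorm_rpow hp0]
  calc ∑' k, ENNReal.ofReal (s k) ^ p
      ≤ ∑' k, 2 ^ (p - 1) * (‖inner ℂ (v k) (S (u k))‖ₑ ^ p + ‖inner ℂ (v k) (T (u k))‖ₑ ^ p) := by
        refine ENNReal.tsum_le_tsum fun k => ?_
        refine le_trans (ENNReal.rpow_le_rpow ?_ hp0.le)
          (ENNReal.rpow_add_le_mul_rpow_add_rpow _ _ hp)
        refine le_trans (le_of_eq ?_) (enorm_add_le _ _)
        rw [← inner_add_right, ← add_apply, h.inner_right,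
          inner_self_eq_norm_sq_to_K, h.left.1, ← ofReal_norm]
        simp [abs_of_nonneg (h.nonneg k)]
    _ ≤ _ := by
        rw [ENNReal.tsum_mul_left, ENNReal.tsum_add]
        gcongr
        · exact h₁.tsum_enorm_inner_rpow_le h.left h.right hp
        · exact h₂.tsum_enorm_inner_rpow_le h.left h.right hp

/-! ### The complexification as diagonal plus antidiagonal part -/

theorem linearPart_restrictScalars (C : H →L[ℂ] H) : linearPart (C.restrictScalars ℝ) = C := by
  ext x
  change (1 / 2 : ℂ) • (C x - Complex.I • C (Complex.I • x)) = C x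
  rw [map_smul, smul_smul, Complex.I_mul_I]
  module

theorem antilinearPart_restrictScalars (C : H →L[ℂ] H) :
    antilinearPart (C.restrictScalars ℝ) = 0 := by
  ext x
  change (1 / 2 : ℂ) • (C x + Complex.I • C (Complex.I • x)) = 0
  rw [map_smul, smul_smul, Complex.I_mul_I]
  module

theorem linearPart_antilinearToReal (A : H →L⋆[ℂ] H) : linearPart (antilinearToReal A) = 0 := by
  ext x
  change (1 / 2 : ℂ) • (A x - Complex.I • A (Complex.I • x)) = 0
  rw [map_smulₛₗ, smul_smul, Complex.conj_I, mul_neg, Complex.I_mul_I]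
  module

theorem antilinearPart_antilinearToReal (A : H →L⋆[ℂ] H) :
    antilinearPart (antilinearToReal A) = A := by
  ext x
  change (1 / 2 : ℂ) • (A x + Complex.I • A (Complex.I • x)) = A x
  rw [map_smulₛₗ, smul_smul, Complex.conj_I, mul_neg, Complex.I_mul_I]
  module

theorem complexification_restrictScalars_apply (κ : H ≃ₗᵢ⋆[ℂ] H) (C : H →L[ℂ] H) (x y : H) :
    complexification κ (C.restrictScalars ℝ) (WithLp.toLp 2 (x, y)) =
      WithLp.toLp 2 (C x, κ (C (κ y))) := by
  rw [complexification_apply, linearPart_restrictScalars, antilinearPart_restrictScalars]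
  simp

/-- The complex linear operator `κ A` for an antilinear operator `A`. -/
def conjComp (κ : H ≃ₗᵢ⋆[ℂ] H) (A : H →L⋆[ℂ] H) : H →L[ℂ] H :=
  (κ.toContinuousLinearEquiv : H →L⋆[ℂ] H).comp A

theorem conjComp_apply (κ : H ≃ₗᵢ⋆[ℂ] H) (A : H →L⋆[ℂ] H) (x : H) :
    conjComp κ A x = κ (A x) := rfl

theorem complexification_antilinearToReal_apply (κ : H ≃ₗᵢ⋆[ℂ] H) (hκ : ∀ x, κ (κ x) = x)
    (A : H →L⋆[ℂ] H) (x y : H) :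
    complexification κ (antilinearToReal A) (WithLp.toLp 2 (x, y)) =
      WithLp.toLp 2 (κ (conjComp κ A (κ y)), conjComp κ A x) := by
  rw [complexification_apply, linearPart_antilinearToReal, antilinearPart_antilinearToReal]
  simp [conjComp_apply, hκ]

theorem complexification_eq_add (κ : H ≃ₗᵢ⋆[ℂ] H) (hκ : ∀ x, κ (κ x) = x) (R : H →L[ℝ] H) :
    complexification κ R = complexification κ ((linearPart R).restrictScalars ℝ) +
      complexification κ (antilinearToReal (antilinearPart R)) := by
  refine ContinuousLinearMap.ext fun z => ?_
  obtain ⟨x, y⟩ := z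
  rw [add_apply, complexification_apply, complexification_restrictScalars_apply,
    complexification_antilinearToReal_apply κ hκ, ← WithLp.toLp_add, Prod.mk_add_mk,
    conjComp_apply, hκ, conjComp_apply, add_comm (κ (antilinearPart R x))]

theorem isCompactOperator_complexification (κ : H ≃ₗᵢ⋆[ℂ] H) {R : H →L[ℝ] H}
    (hR : IsCompactRealLinear R) : IsCompactOperator (complexification κ R) := by
  obtain ⟨hC, hA⟩ := hR
  let x₁ := (ContinuousLinearMap.fst ℂ H H).comp
    (WithLp.prodContinuousLinearEquiv 2 ℂ H H : WithLp 2 (H × H) →L[ℂ] (H × H))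
  let x₂ := (ContinuousLinearMap.snd ℂ H H).comp
    (WithLp.prodContinuousLinearEquiv 2 ℂ H H : WithLp 2 (H × H) →L[ℂ] (H × H))
  have h : IsCompactOperator fun z =>
      blockInl (linearPart R (x₁ z) + antilinearPart R (κ (x₂ z))) +
      blockInr (κ (antilinearPart R (x₁ z)) + κ (linearPart R (κ (x₂ z)))) := by
    let k : H →L⋆[ℂ] H := (κ.toContinuousLinearEquiv : H →L⋆[ℂ] H)
    exact (((hC.comp_clm x₁).add ((hA.comp_clm k).comp_clm x₂)).clm_comp blockInl).add
      ((((hA.clm_comp k).comp_clm x₁).add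
        ((((hC.clm_comp k).comp_clm k)).comp_clm x₂)).clm_comp blockInr)
  convert! h using 1
  funext z
  rw [blockInl_add_blockInr]
  rfl

/-! ### Reduction of antilinear operators to complex linear ones -/

variable [CompleteSpace H]

/-- Both forms agree: `⟨A*A z, x⟩ = ⟨A x, A z⟩ = ⟨κA z, κA x⟩`. -/
theorem antilinearAdjoint_comp_self (κ : H ≃ₗᵢ⋆[ℂ] H) (A : H →L⋆[ℂ] H) :
    (antilinearAdjoint A).comp A =
      (ContinuousLinearMap.adjoint (conjComp κ A)).comp (conjComp κ A) := by
  refine ContinuousLinearMap.ext fun z => ext_inner_right ℂ fun x => ?_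
  rw [ContinuousLinearMap.comp_apply, ContinuousLinearMap.comp_apply, inner_antilinearAdjoint,
    ContinuousLinearMap.adjoint_inner_left, conjComp_apply, conjComp_apply, inner_conjugation]

theorem antilinearSingularNumber_eq (κ : H ≃ₗᵢ⋆[ℂ] H) (A : H →L⋆[ℂ] H) :
    antilinearSingularNumber A = singularNumber (conjComp κ A) := by
  funext j
  rw [antilinearSingularNumber, singularNumber, antilinearAdjoint_comp_self κ]

theorem antilinearSchattenNorm_eq (κ : H ≃ₗᵢ⋆[ℂ] H) (A : H →L⋆[ℂ] H) (p : ℝ) :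
    antilinearSchattenNorm p A = schattenNorm p (conjComp κ A) := by
  rw [antilinearSchattenNorm, schattenNorm, antilinearSingularNumber_eq κ]

theorem antilinearMemSchatten_iff (κ : H ≃ₗᵢ⋆[ℂ] H) {A : H →L⋆[ℂ] H} (hA : IsCompactOperator A)
    {p : ℝ} (hp : 0 < p) :
    AntilinearMemSchatten p A ↔ antilinearSchattenNorm p A ^ p ≠ ⊤ := by
  have hB : IsCompactOperator (conjComp κ A) :=
    hA.clm_comp (κ.toContinuousLinearEquiv : H →L⋆[ℂ] H)
  have h := memSchatten_iff (conjComp κ A) hp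
  rw [MemSchatten, and_congr_right_iff] at h
  rw [AntilinearMemSchatten, antilinearSingularNumber_eq κ, antilinearSchattenNorm_eq κ, h hB]
  exact and_iff_right hA

end RealLinear

end

open RealLinear

/-! ### The main theorem -/

theorem proposition2 {H : Type*} [NormedAddCommGroup H] [InnerProductSpace ℂ H] [CompleteSpace H]
    [TopologicalSpace.SeparableSpace H]
    (p : ℝ) (hp : 1 ≤ p)
    (R : H →L[ℝ] H) (hR : RealLinear.IsCompactRealLinear R)
    (κ : H ≃ₗᵢ⋆[ℂ] H) (hκ : ∀ x, κ (κ x) = x) :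
    (RealLinear.MemSchatten p (RealLinear.complexification κ R) ↔
      RealLinear.RealMemSchatten p R) ∧
    RealLinear.schattenNorm p (RealLinear.linearPart R) ^ p +
        RealLinear.antilinearSchattenNorm p (RealLinear.antilinearPart R) ^ p ≤
      RealLinear.schattenNorm p (RealLinear.complexification κ R) ^ p ∧
    RealLinear.schattenNorm p
        (RealLinear.complexification κ ((RealLinear.linearPart R).restrictScalars ℝ)) ^ p =
      2 * RealLinear.schattenNorm p (RealLinear.linearPart R) ^ p ∧
    RealLinear.schattenNorm p
        (RealLinear.complexification κ
          (RealLinear.antilinearToReal (RealLinear.antilinearPart R))) ^ p =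
      2 * RealLinear.antilinearSchattenNorm p (RealLinear.antilinearPart R) ^ p := by
  have hp0 : 0 < p := by linarith
  obtain ⟨hC, hA⟩ := hR
  have hB : IsCompactOperator (conjComp κ (antilinearPart R)) :=
    hA.clm_comp (κ.toContinuousLinearEquiv : H →L⋆[ℂ] H)
  have hRc := isCompactOperator_complexification κ (R := R) ⟨hC, hA⟩
  have hDc : IsCompactOperator (complexification κ ((linearPart R).restrictScalars ℝ)) := by
    refine isCompactOperator_complexification κ ⟨?_, ?_⟩
    · rwa [linearPart_restrictScalars]
    · rw [antilinearPart_restrictScalars]; exact isCompactOperator_zero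
  have hOc : IsCompactOperator (complexification κ (antilinearToReal (antilinearPart R))) := by
    refine isCompactOperator_complexification κ ⟨?_, ?_⟩
    · rw [linearPart_antilinearToReal]; exact isCompactOperator_zero
    · rwa [antilinearPart_antilinearToReal]
  obtain ⟨ι, u, v, s, hu⟩ := exists_isSingularDecomposition hC
  obtain ⟨ι', w, z, t, hw⟩ := exists_isSingularDecomposition hB
  have hD := hu.blockDiagonal κ hκ (complexification_restrictScalars_apply κ (linearPart R))
  have hO := hw.blockAntidiagonal κ hκ
    (complexification_antilinearToReal_apply κ hκ (antilinearPart R))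
  have hDn := hu.schattenNorm_rpow_eq_two_mul hD hp0
  have hOn := hw.schattenNorm_rpow_eq_two_mul hO hp0
  rw [← antilinearSchattenNorm_eq] at hOn
  have hsum := complexification_eq_add κ hκ R
  -- Paired left and right singular vectors of the diagonal part lie in the same summand, while the
  -- antidiagonal part exchanges the summands.
  have hDle := hD.schattenNorm_rpow_le hRc (by
    rw [hsum]
    rintro (k | k) <;>
    simp [blockInl_apply, blockInr_apply, complexification_antilinearToReal_apply κ hκ]) hp
  -- Here paired singular vectors lie in opposite summands, while the diagonal part preserves each
  -- summand.
  have hOle := hO.schattenNorm_rpow_le hRc (by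
    rw [hsum]
    rintro (k | k) <;>
    simp [blockInl_apply, blockInr_apply, complexification_restrictScalars_apply]) hp
  have hle : schattenNorm p (linearPart R) ^ p + antilinearSchattenNorm p (antilinearPart R) ^ p ≤
      schattenNorm p (complexification κ R) ^ p := by
    rw [← ENNReal.mul_le_mul_iff_right two_ne_zero ENNReal.ofNat_ne_top, mul_add, ← hDn, ← hOn,
      two_mul]
    exact add_le_add hDle hOle
  refine ⟨?_, hle, hDn, hOn⟩
  rw [memSchatten_iff _ hp0, RealMemSchatten, memSchatten_iff _ hp0,
    antilinearMemSchatten_iff κ hA hp0, and_iff_right hRc, and_iff_right hC]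
  refine ⟨fun h => ?_, fun h => ?_⟩
  · rw [← ENNReal.add_ne_top]
    exact ne_top_of_le_ne_top h hle
  · have h1 := schattenNorm_add_rpow_le hDc hOc hp
    rw [← hsum, hDn, hOn, ← mul_add] at h1
    exact ne_top_of_le_ne_top (ENNReal.mul_ne_top
      (ENNReal.rpow_ne_top_of_nonneg (by linarith) ENNReal.ofNat_ne_top)
      (ENNReal.mul_ne_top ENNReal.ofNat_ne_top (ENNReal.add_ne_top.2 h))) h1
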